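/- Let $A=S^1\times[0,1]$ with $S^1=\mathbb R/\mathbb Z$, let $\tilde A=\mathbb R\times[0,1]$ be its universal cover, and let $p_1:\tilde A\to\mathbb R$ be the first projection. Let $f:A\to A$ be a homeomorphism that preserves orientation and maps each boundary component of $A$ to itself, and let $\tilde f:\tilde A\to\tilde A$ be a lift of $f$ (so $\tilde f(\tilde x+1,\tilde y)=\tilde f(\tilde x,\tilde y)+(1,0)$) which is transitive, i.e. has a dense orbit. Assume that for $i=0,1$ the rotation number $\rho(\tilde f|_{\mathbb R\times\{i\}})=\lim_{n\to\infty}\frac{p_1(\tilde f^n(\tilde x,i))-\tilde x}{n}$ (which exists and does not depend on $\tilde x$) is strictly positive. Let $$B=\bigcap_{n\le 0}\tilde f^{\,n}\big(\,]-\infty,0]\times[0,1]\,\big),$$ and let $B^-\subset B$ be the union of those connected components of $B$ that are unbounded (necessarily to the left). Then $$\omega(B^-)=\bigcap_{n=0}^{\infty}\overline{\bigcup_{i=n}^{\infty}\tilde f^{\,i}(B^-)}=\emptyset .$$ Moreover the iterates of $B^-$ converge to the left end of the strip: for every $a\in\mathbb R$ there is $N$ such that $\tilde f^{\,n}(B^-)\subset\,]-\infty,a]\times[0,1]$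 for all $n\ge N$. -/

import Mathlib

open Set Filter Topology

noncomputable section

/-- The closed annulus `S¹ × [0,1]`, with `S¹ = ℝ/ℤ`. -/
abbrev Annulus : Type := UnitAddCircle × unitInterval

/-- The infinite strip `ℝ × [0,1]`, the universal cover of the annulus. -/
abbrev Strip : Type := ℝ × unitInterval

/-- The covering map from the strip to the annulus. -/
def Strip.proj (z : Strip) : Annulus := ((z.1 : UnitAddCircle), z.2)

/-- The generator `(x, y) ↦ (x + 1, y)` of the deck group. -/
def Strip.shift (z : Strip) : Strip := (z.1 + 1, z.2)

/-- `f` maps each of the two boundary circles of the annulus onto itself. -/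
def PreservesBoundaryComponents (f : Annulus ≃ₜ Annulus) : Prop :=
  ∀ i : unitInterval, (i = 0 ∨ i = 1) →
    f '' {z : Annulus | z.2 = i} = {z : Annulus | z.2 = i}

/-- A homeomorphism of the closed annulus that maps each boundary circle to itself preserves
orientation if and only if it acts trivially on the fundamental group of the annulus, that is, if
its lifts to the strip commute with the deck transformation `(x, y) ↦ (x + 1, y)`
(lifts always exist; in the orientation reversing case `F (x + 1, y) = F (x, y) - (1, 0)`). -/
def PreservesOrientation (f : Annulus ≃ₜ Annulus) : Prop :=
  ∀ F : Strip → Strip, Continuous F → (∀ z, (F z).proj = f z.proj) →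
    ∀ z, F z.shift = (F z).shift

/-- Homeomorphisms of the closed annulus preserving orientation and the boundary components. -/
structure AnnulusHomeo where
  /-- the underlying homeomorphism -/
  toHomeomorph : Annulus ≃ₜ Annulus
  boundary : PreservesBoundaryComponents toHomeomorph
  orientation : PreservesOrientation toHomeomorph

/-- The lifts of `f` to homeomorphisms of the strip. -/
structure AnnulusHomeo.Lift (f : AnnulusHomeo) where
  /-- the underlying homeomorphism of the strip -/
  toHomeomorph : Strip ≃ₜ Strip
  proj_apply : ∀ z, (toHomeomorph z).proj = f.toHomeomorph z.proj

namespace AnnulusHomeo.Lift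

variable {f : AnnulusHomeo} (F : f.Lift)

theorem apply_boundary (i : unitInterval) (hi : i = 0 ∨ i = 1) (x : ℝ) :
    (F.toHomeomorph (x, i)).2 = i := by
  have h1 : f.toHomeomorph (Strip.proj (x, i)) ∈ {z : Annulus | z.2 = i} := by
    rw [← f.boundary i hi]
    exact mem_image_of_mem _ rfl
  rw [← F.proj_apply] at h1
  exact h1

theorem apply_add_one (x : ℝ) (i : unitInterval) :
    (F.toHomeomorph (x + 1, i)).1 = (F.toHomeomorph (x, i)).1 + 1 :=
  congrArg Prod.fst (f.orientation F.toHomeomorph F.toHomeomorph.continuous F.proj_apply (x, i))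

theorem monotone_boundary (i : unitInterval) (hi : i = 0 ∨ i = 1) :
    Monotone fun x : ℝ => (F.toHomeomorph (x, i)).1 := by
  have hc : Continuous fun x : ℝ => (F.toHomeomorph (x, i)).1 := by fun_prop
  have hinj : Function.Injective fun x : ℝ => (F.toHomeomorph (x, i)).1 := by
    intro x y hxy
    have h : F.toHomeomorph (x, i) = F.toHomeomorph (y, i) :=
      Prod.ext hxy ((F.apply_boundary i hi x).trans (F.apply_boundary i hi y).symm)
    exact congrArg Prod.fst (F.toHomeomorph.injective h)
  rcases hc.strictMono_of_inj hinj with h | h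
  · exact h.monotone
  · exfalso
    have h1 := h (show (0 : ℝ) < 0 + 1 by norm_num)
    have h2 := F.apply_add_one 0 i
    simp only at h1
    linarith

/-- The restriction of the lift to the boundary line `ℝ × {i}`, `i ∈ {0, 1}`, as a monotone map
of degree one of the real line. -/
def boundaryMap (i : unitInterval) (hi : i = 0 ∨ i = 1) : CircleDeg1Lift where
  toFun x := (F.toHomeomorph (x, i)).1
  monotone' := F.monotone_boundary i hi
  map_add_one' x := F.apply_add_one x i

/-- The rotation number of the lift restricted to the boundary line `ℝ × {i}`, i.e.
`lim (p₁ (Fⁿ (x, i)) - x) / n`. -/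
def boundaryRotationNumber (i : unitInterval) (hi : i = 0 ∨ i = 1) : ℝ :=
  (F.boundaryMap i hi).translationNumber

/-- The lift is transitive: it has a dense orbit. -/
def IsTransitive : Prop :=
  ∃ z : Strip, Dense (range fun n : ℤ => (F.toHomeomorph ^ n) z)

/-- The set `B = ⋂_{n ≤ 0} Fⁿ (]-∞, 0] × [0, 1])`. -/
def B : Set Strip :=
  ⋂ (n : ℤ) (_ : n ≤ 0), (F.toHomeomorph ^ n) '' {z : Strip | z.1 ≤ 0}

/-- The set `B⁻`: the union of the connected components of `B` that are unbounded to the left. -/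
def Bminus : Set Strip :=
  {z | z ∈ F.B ∧ ¬ BddBelow (Prod.fst '' connectedComponentIn F.B z)}

/-- The ω-limit set `⋂ₙ closure (⋃_{i ≥ n} Fⁱ (D))` of a set `D`. -/
def omegaLimitSet (D : Set Strip) : Set Strip :=
  ⋂ n : ℕ, closure (⋃ (i : ℕ) (_ : n ≤ i), (F.toHomeomorph ^ i) '' D)

end AnnulusHomeo.Lift

end

/-! ### Crossing lemmas in the strip -/

/-! Write `G` for the lift and `K` for the ω-limit set of `B⁻`. `K` is closed, invariant and bounded
to the right, and by compactness each of its points lies in a connected subset of `K` unbounded to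
the left (`isLeftUnbounded_iInter`). Positive rotation numbers mean that `G` moves every boundary
point to the right, hence also every point of height less than some `ε`, and likewise near the top.
Such a `K` is empty (`eq_empty_of_isLeftUnbounded`).

`K` misses the bottom line, since the rightmost point of its trace there would be moved further
right inside `K`. Moreover `K` stays above height `ε` (`IsRightward.le_snd`). Otherwise a vertical
segment from the bottom line to a point of `K`, together with `K`, separates the left part of the
bottom line from the right part. As `G` pushes the segment to the right, the left region is backward
invariant and some of its points escape into the right region. A dense orbit forbids this
(`isNontrapping_of_dense`). The same holds at the top by reflection.

Transitivity makes an iterate of the low strip meet the high strip, which gives a path from bottom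
to top avoiding every integer translate of `K`. An unbounded connected subset of `K`, translated far
to the right, must cross this path, a contradiction. The plane topology used here reduces to two
crossing lemmas, proved by a winding argument. -/

instance : LocallyPathConnectedSpace unitInterval :=
  (IsQuotientMap.of_inverse (f := ((↑) : unitInterval → ℝ)) (g := projIcc (0 : ℝ) 1 zero_le_one)
    continuous_subtype_val continuous_projIcc
    fun x => projIcc_val zero_le_one x).locallyPathConnectedSpace

/-- A continuous logarithm of `w` differs by a constant from the principal logarithm of `c * w` on
a connected set where `c * w` takes its values in the slit plane. -/
theorem Complex.sub_log_eq_of_isPreconnected {X : Type*} [TopologicalSpace X] {w h : X → ℂ}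
    (hw : Continuous w) (hh : Continuous h) (hexp : ∀ x, Complex.exp (h x) = w x) (c : ℂ)
    {u : Set X} (hu : IsPreconnected u) (hslit : ∀ x ∈ u, c * w x ∈ Complex.slitPlane)
    {x y : X} (hx : x ∈ u) (hy : y ∈ u) :
    h x - Complex.log (c * w x) = h y - Complex.log (c * w y) := by
  have hcont : ContinuousOn (fun x => h x - Complex.log (c * w x)) u :=
    hh.continuousOn.sub ((continuous_const.mul hw).continuousOn.clog hslit)
  have hval : ∀ z ∈ u, Complex.exp (h z - Complex.log (c * w z)) = c⁻¹ := by
    intro z hz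
    have hcz := Complex.slitPlane_ne_zero (hslit z hz)
    have hc := left_ne_zero_of_mul hcz
    have hwz := right_ne_zero_of_mul hcz
    rw [Complex.exp_sub, hexp, Complex.exp_log hcz]
    field_simp
  -- The exponential of the difference is constant, so the difference takes values in a translate of
  -- `2πiℤ`; this set is countable, hence totally disconnected.
  have hd : MapsTo (fun x => h x - Complex.log (c * w x)) u (range fun n : ℤ =>
      h x - Complex.log (c * w x) + n * (2 * Real.pi * Complex.I)) := fun z hz => by
    obtain ⟨n, hn⟩ := Complex.exp_eq_exp_iff_exists_int.1 ((hval z hz).trans (hval x hx).symm)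
    exact ⟨n, hn.symm⟩
  exact (countable_range _).isTotallyDisconnected _ (mapsTo_iff_image_subset.1 hd)
    (hu.image _ hcont) (mem_image_of_mem _ hx) (mem_image_of_mem _ hy)

/-- A continuous nowhere vanishing function on a simply connected space cannot wind around the
origin: the two halves of a loop, taking values in opposite slit planes, cannot join the open upper
half plane to the open lower half plane. -/
theorem Complex.false_of_winding {X : Type*} [TopologicalSpace X] [SimplyConnectedSpace X]
    [LocallyPathConnectedSpace X] {w : X → ℂ} (hw : Continuous w) (hw0 : ∀ x, w x ≠ 0)
    {s t : Set X} (hs : IsPreconnected s) (ht : IsPreconnected t)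
    (hws : ∀ x ∈ s, w x ∈ Complex.slitPlane) (hwt : ∀ x ∈ t, -w x ∈ Complex.slitPlane)
    {p q : X} (hps : p ∈ s) (hpt : p ∈ t) (hqs : q ∈ s) (hqt : q ∈ t)
    (hp : 0 < (w p).im) (hq : (w q).im < 0) : False := by
  obtain ⟨h, ⟨-, hh⟩, -⟩ := Complex.isCoveringMapOn_exp.existsUnique_continuousMap_lifts
    (⟨w, hw⟩ : C(X, ℂ)) (Complex.exp_log (hw0 p)) hw0
  have hexp : ∀ x, Complex.exp (h x) = w x := fun x => congrFun hh x
  have h1 := Complex.sub_log_eq_of_isPreconnected hw h.continuous hexp 1 hs (by simpa using hws)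
    hps hqs
  have h2 := Complex.sub_log_eq_of_isPreconnected hw h.continuous hexp (-1) ht (by simpa using hwt)
    hpt hqt
  simp only [one_mul, neg_mul] at h1 h2
  have h3 : (Complex.log (w p)).im - (Complex.log (w q)).im =
      (Complex.log (-w p)).im - (Complex.log (-w q)).im := by
    rw [← Complex.sub_im, ← Complex.sub_im]
    congr 1
    linear_combination h2 - h1
  -- Passing from `w` to `-w` lowers the argument by `π` at `p` and raises it by `π` at `q`, so `h3`
  -- becomes `0 = -2π`.
  simp only [Complex.log_im, Complex.arg_neg_eq_arg_sub_pi_of_im_pos hp,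
    Complex.arg_neg_eq_arg_add_pi_of_im_neg hq] at h3
  linarith [Real.pi_pos]

namespace Strip

/-- The difference of two points of the strip, as a complex number in coordinates rotated by
`π / 4`. -/
def rotatedSub (z z' : Strip) : ℂ :=
  ⟨(z.1 - z'.1) - ((z.2 : ℝ) - z'.2), (z.1 - z'.1) + ((z.2 : ℝ) - z'.2)⟩

theorem continuous_rotatedSub : Continuous fun p : Strip × Strip => rotatedSub p.1 p.2 := by
  have : (fun p : Strip × Strip => rotatedSub p.1 p.2) = fun p =>
      (((p.1.1 - p.2.1) - ((p.1.2 : ℝ) - p.2.2) : ℝ) : ℂ) +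
        (((p.1.1 - p.2.1) + ((p.1.2 : ℝ) - p.2.2) : ℝ) : ℂ) * Complex.I := by
    funext p
    apply Complex.ext <;> simp [rotatedSub]
  rw [this]
  fun_prop

theorem rotatedSub_ne_zero {z z' : Strip} (h : z ≠ z') : rotatedSub z z' ≠ 0 := by
  intro h0
  have h1 := congrArg Complex.re h0
  have h2 := congrArg Complex.im h0
  simp only [rotatedSub, Complex.zero_re, Complex.zero_im] at h1 h2
  exact h (Prod.ext (by linarith) (Subtype.ext (by linarith)))

/-- The rotation turns the excluded negative real axis into the direction "up and to the left".
Being no higher, or strictly to the right, each rules it out, so both kinds of sides of the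
parameter square fit in one slit plane. -/
theorem rotatedSub_mem_slitPlane {z z' : Strip} (h : z ≠ z')
    (hz : (z.2 : ℝ) ≤ z'.2 ∨ z'.1 < z.1) : rotatedSub z z' ∈ Complex.slitPlane := by
  have h0 := rotatedSub_ne_zero h
  rw [Complex.mem_slitPlane_iff]
  by_contra! hc
  apply h0
  simp only [rotatedSub] at hc
  apply Complex.ext
  · simp only [rotatedSub, Complex.zero_re]
    rcases hz with hz | hz <;> linarith
  · exact hc.2

theorem neg_rotatedSub (z z' : Strip) : -rotatedSub z z' = rotatedSub z' z := by
  apply Complex.ext <;> simp [rotatedSub] <;> ring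

/-- The two crossing lemmas below, in terms of the boundary of the square of parameters. -/
theorem exists_eq_of_paths {a b c d : Strip} (σ : Path a b) (τ : Path c d)
    {s t : Set (ℝ × ℝ)} (hs : IsPreconnected s) (ht : IsPreconnected t)
    (hs' : ∀ x ∈ s, ((σ.extend x.1).2 : ℝ) ≤ (τ.extend x.2).2 ∨
      (τ.extend x.2).1 < (σ.extend x.1).1)
    (ht' : ∀ x ∈ t, ((τ.extend x.2).2 : ℝ) ≤ (σ.extend x.1).2 ∨
      (σ.extend x.1).1 < (τ.extend x.2).1)
    {p q : ℝ × ℝ} (hps : p ∈ s) (hpt : p ∈ t) (hqs : q ∈ s) (hqt : q ∈ t)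
    (hp : 0 < (rotatedSub (σ.extend p.1) (τ.extend p.2)).im)
    (hq : (rotatedSub (σ.extend q.1) (τ.extend q.2)).im < 0) :
    ∃ x y, σ x = τ y := by
  by_contra! hne
  have hne' : ∀ x : ℝ × ℝ, σ.extend x.1 ≠ τ.extend x.2 := fun x => hne _ _
  refine Complex.false_of_winding (X := ℝ × ℝ)
    (w := fun x => rotatedSub (σ.extend x.1) (τ.extend x.2)) ?_
    (fun x => rotatedSub_ne_zero (hne' x)) hs ht
    (fun x hx => rotatedSub_mem_slitPlane (hne' x) (hs' x hx)) (fun x hx => ?_)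
    hps hpt hqs hqt hp hq
  · exact continuous_rotatedSub.comp ((σ.continuous_extend.comp continuous_fst).prodMk
      (τ.continuous_extend.comp continuous_snd))
  · rw [neg_rotatedSub]
    exact rotatedSub_mem_slitPlane (hne' x).symm (ht' x hx)

theorem isPreconnected_vertical (r : ℝ) : IsPreconnected {x : ℝ × ℝ | x.1 = r} := by
  have : {x : ℝ × ℝ | x.1 = r} = {r} ×ˢ univ := by ext; simp
  rw [this]
  exact isPreconnected_singleton.prod isPreconnected_univ

theorem isPreconnected_horizontal (r : ℝ) : IsPreconnected {x : ℝ × ℝ | x.2 = r} := by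
  have : {x : ℝ × ℝ | x.2 = r} = univ ×ˢ {r} := by ext; simp
  rw [this]
  exact isPreconnected_univ.prod isPreconnected_singleton

theorem isPreconnected_cross (r r' : ℝ) : IsPreconnected ({x : ℝ × ℝ | x.1 = r} ∪ {x | x.2 = r'}) :=
  (isPreconnected_vertical r).union (r, r') rfl rfl (isPreconnected_horizontal r')

/-- A path from the bottom to the top of the strip meets every path from its left to its right. -/
theorem exists_eq_of_bottom_top {a b c d : Strip} (σ : Path a b) (τ : Path c d)
    (ha : a.2 = 0) (hb : b.2 = 1) (hc : ∀ x, c.1 < (σ x).1) (hd : ∀ x, (σ x).1 < d.1) :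
    ∃ x y, σ x = τ y := by
  have hc' : ∀ x : ℝ, c.1 < (σ.extend x).1 := fun x => hc _
  have hd' : ∀ x : ℝ, (σ.extend x).1 < d.1 := fun x => hd _
  have h0 : ∀ z : Strip, (0 : ℝ) ≤ z.2 := fun z => z.2.2.1
  have h1 : ∀ z : Strip, (z.2 : ℝ) ≤ 1 := fun z => z.2.2.2
  -- Extended paths are constant outside `[0,1]`, so full lines can replace the sides of the square.
  -- On the first cross `σ` is at the bottom or `τ` is at its left end; on the second `σ` is at the
  -- top or `τ` is at its right end. The corners `p` and `q` lie on both.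
  refine exists_eq_of_paths σ τ (isPreconnected_cross 0 0) (isPreconnected_cross 1 1)
    ?_ ?_ (p := (1, 0)) (q := (0, 1)) (.inr rfl) (.inl rfl) (.inl rfl) (.inr rfl) ?_ ?_
  · rintro ⟨x, y⟩ (rfl | rfl)
    · left; simpa [ha] using h0 _
    · right; simpa using hc' x
  · rintro ⟨x, y⟩ (rfl | rfl)
    · left; simpa [hb] using h1 _
    · right; simpa using hd' x
  · have := hc' 1
    have := h1 c
    simp_all [rotatedSub]
    linarith
  · have := hd' 0
    have := h0 d
    simp_all [rotatedSub]
    linarith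

/-- A path joining two points of the bottom line meets every path that starts between them on the
bottom line and ends to the left of the first path. -/
theorem exists_eq_of_bottom_bottom {a b c d : Strip} (σ : Path a b) (τ : Path c d)
    (ha : a.2 = 0) (hb : b.2 = 0) (hc : c.2 = 0) (hac : a.1 < c.1) (hcb : c.1 < b.1)
    (hd : ∀ x, d.1 < (σ x).1) : ∃ x y, σ x = τ y := by
  have hd' : ∀ x : ℝ, d.1 < (σ.extend x).1 := fun x => hd _
  have h0 : ∀ z : Strip, (0 : ℝ) ≤ z.2 := fun z => z.2.2.1
  -- Three sides against one: `σ` is at the bottom on both vertical sides and `τ` at its left end on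
  -- the upper one, while `τ` is at the bottom on the remaining side.
  refine exists_eq_of_paths σ τ
    (IsPreconnected.union (t := {x : ℝ × ℝ | x.1 = 1}) (1, 1) (.inr rfl) rfl
      (isPreconnected_cross 0 1) (isPreconnected_vertical 1))
    (isPreconnected_horizontal 0)
    ?_ ?_ (p := (1, 0)) (q := (0, 0)) (.inr rfl) rfl (.inl (.inl rfl)) rfl ?_ ?_
  · rintro ⟨x, y⟩ ((rfl | rfl) | rfl)
    · left; simpa [ha] using h0 _
    · right; simpa using hd' x
    · left; simpa [hb] using h0 _
  · rintro ⟨x, y⟩ rfl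
    left; simpa [hc] using h0 _
  · simp [rotatedSub, hb, hc, hcb]
  · simp [rotatedSub, ha, hc, hac]

/-- Two points of a connected subset of an open set are joined by a path in the open set. -/
theorem joinedIn_of_isPreconnected {Q U : Set Strip} (hQ : IsPreconnected Q) (hU : IsOpen U)
    (hQU : Q ⊆ U) {c d : Strip} (hc : c ∈ Q) (hd : d ∈ Q) : JoinedIn U c d := by
  have hconn : IsConnected (connectedComponentIn U c) :=
    isConnected_connectedComponentIn_iff.2 (hQU hc)
  have hpath := hU.connectedComponentIn.isConnected_iff_isPathConnected.1 hconn
  have hsub := hQ.subset_connectedComponentIn hc hQU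
  exact (hpath.joinedIn c (hsub hc) d (hsub hd)).mono (connectedComponentIn_subset U c)

theorem isOpen_compl_range_path {a b : Strip} (σ : Path a b) : IsOpen (range σ)ᶜ :=
  (isCompact_range σ.continuous).isClosed.isOpen_compl

/-- A path from the bottom to the top of the strip meets every connected set that has points to
its left and to its right. -/
theorem exists_mem_of_bottom_top {a b : Strip} (σ : Path a b) (ha : a.2 = 0) (hb : b.2 = 1)
    {Q : Set Strip} (hQ : IsPreconnected Q) {c d : Strip} (hc : c ∈ Q) (hd : d ∈ Q)
    (hcσ : ∀ x, c.1 < (σ x).1) (hdσ : ∀ x, (σ x).1 < d.1) : ∃ x, σ x ∈ Q := by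
  by_contra! hne
  have hj := joinedIn_of_isPreconnected hQ (isOpen_compl_range_path σ)
    (fun z hz ⟨x, hx⟩ => hne x (hx ▸ hz)) hc hd
  obtain ⟨x, y, hxy⟩ := exists_eq_of_bottom_top σ hj.somePath ha hb hcσ hdσ
  exact hj.somePath_mem y ⟨x, hxy⟩

/-- A path joining two points of the bottom line meets every connected set that contains a point
between them on the bottom line and is unbounded to the left. -/
theorem exists_mem_of_bottom_bottom {a b : Strip} (σ : Path a b) (ha : a.2 = 0) (hb : b.2 = 0)
    {Q : Set Strip} (hQ : IsPreconnected Q) {c : Strip} (hcQ : c ∈ Q) (hc : c.2 = 0)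
    (hac : a.1 < c.1) (hcb : c.1 < b.1) (hunb : ¬ BddBelow (Prod.fst '' Q)) :
    ∃ x, σ x ∈ Q := by
  by_contra! hne
  obtain ⟨m, hm⟩ := (isCompact_range (continuous_fst.comp σ.continuous)).bddBelow
  obtain ⟨-, ⟨d, hd, rfl⟩, hdm⟩ := not_bddBelow_iff.1 hunb m
  have hj := joinedIn_of_isPreconnected hQ (isOpen_compl_range_path σ)
    (fun z hz ⟨x, hx⟩ => hne x (hx ▸ hz)) hcQ hd
  obtain ⟨x, y, hxy⟩ := exists_eq_of_bottom_bottom σ hj.somePath ha hb hc hac hcb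
    (fun x => hdm.trans_le (hm ⟨x, rfl⟩))
  exact hj.somePath_mem y ⟨x, hxy⟩

end Strip

namespace Strip

/-! ### Unbounded connected subsets -/

/-- A set all of whose points lie in a connected subset which is unbounded to the left. -/
def IsLeftUnbounded (K : Set Strip) : Prop :=
  ∀ z ∈ K, ∃ C ⊆ K, z ∈ C ∧ IsPreconnected C ∧ ¬ BddBelow (Prod.fst '' C)

theorem isCompact_inter_of_subset {A : Set Strip} (hA : IsClosed A) {b : ℝ}
    (hb : A ⊆ {z | z.1 ≤ b}) (M : ℝ) : IsCompact (A ∩ {z | M ≤ z.1}) := by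
  refine (isCompact_Icc (a := M) (b := b)).prod (isCompact_univ (X := unitInterval))
    |>.of_isClosed_subset (hA.inter (isClosed_le continuous_const continuous_fst)) ?_
  rintro z ⟨hz, hMz⟩
  exact ⟨⟨hMz, hb hz⟩, mem_univ _⟩

/-- A decreasing intersection of closed sets bounded to the right, in each of which the points
lying in connected subsets unbounded to the left are dense, has the same property. -/
theorem isLeftUnbounded_iInter {A : ℕ → Set Strip} (hanti : Antitone A)
    (hclosed : ∀ n, IsClosed (A n)) {b : ℝ} (hb : ∀ n, A n ⊆ {z | z.1 ≤ b})
    (hA : ∀ n, ∃ S ⊆ A n, A n ⊆ closure S ∧ ∀ z ∈ S, ∃ C ⊆ A n, z ∈ C ∧ IsPreconnected C ∧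
      ¬ BddBelow (Prod.fst '' C)) :
    IsLeftUnbounded (⋂ n, A n) := by
  intro z hz
  refine ⟨connectedComponentIn (⋂ n, A n) z, connectedComponentIn_subset _ _,
    mem_connectedComponentIn hz, isPreconnected_connectedComponentIn, ?_⟩
  rintro ⟨m, hm⟩
  have hmz : m ≤ z.1 := hm ⟨z, mem_connectedComponentIn hz, rfl⟩
  set M : ℝ := m - 1 with hM
  set K : Set Strip := (⋂ n, A n) ∩ {z | M ≤ z.1} with hK
  have hKc : IsCompact K :=
    isCompact_inter_of_subset (isClosed_iInter hclosed) ((iInter_subset _ 0).trans (hb 0)) M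
  have hzK : z ∈ K := ⟨hz, by simp only [mem_ofPred_eq]; linarith⟩
  have : CompactSpace K := isCompact_iff_compactSpace.1 hKc
  -- In the compact slice `K` components are intersections of clopen sets, so a component avoiding
  -- the edge `z.1 = M` is contained in a clopen set avoiding it.
  obtain ⟨Z, hZclopen, hzZ, hZM⟩ : ∃ Z : Set K, IsClopen Z ∧ (⟨z, hzK⟩ : K) ∈ Z ∧
      ∀ w ∈ Z, M < w.1.1 := by
    have hopen : IsOpen {w : K | M < w.1.1} :=
      isOpen_lt continuous_const (continuous_fst.comp continuous_subtype_val)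
    have hsub : (⋂ s : {s : Set K // IsClopen s ∧ (⟨z, hzK⟩ : K) ∈ s}, (s : Set K)) ⊆
        {w : K | M < w.1.1} := by
      rw [← connectedComponent_eq_iInter_isClopen]
      intro w hw
      have hw' : (w : Strip) ∈ connectedComponentIn (⋂ n, A n) z := by
        refine (isPreconnected_connectedComponent.image _
          continuous_subtype_val.continuousOn).subset_connectedComponentIn
          (mem_image_of_mem _ (mem_connectedComponent (x := (⟨z, hzK⟩ : K)))) ?_
          (mem_image_of_mem _ hw)
        rintro _ ⟨v, -, rfl⟩
        exact v.2.1
      have := hm ⟨_, hw', rfl⟩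
      simp only [mem_ofPred_eq]
      linarith
    have : Nonempty {s : Set K // IsClopen s ∧ (⟨z, hzK⟩ : K) ∈ s} :=
      ⟨⟨univ, isClopen_univ, mem_univ _⟩⟩
    obtain ⟨s, hs⟩ := exists_subset_nhds_of_compactSpace
      (V := fun s : {s : Set K // IsClopen s ∧ (⟨z, hzK⟩ : K) ∈ s} => (s : Set K))
      (fun s t => ⟨⟨s ∩ t, s.2.1.inter t.2.1, s.2.2, t.2.2⟩, inter_subset_left,
        inter_subset_right⟩) (fun s => s.2.1.isClosed)
      (fun w hw => hopen.mem_nhds (hsub hw))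
    exact ⟨s, s.2.1, s.2.2, hs⟩
  obtain ⟨O, O', hO, hO', hZO, hZO', hdisj⟩ := SeparatedNhds.of_isCompact_isCompact
    (hZclopen.isClosed.isCompact.image continuous_subtype_val)
    (hZclopen.compl.isClosed.isCompact.image continuous_subtype_val)
    ((disjoint_image_iff Subtype.val_injective).2 disjoint_compl_right)
  have hMo : IsOpen {z : Strip | M < z.1} := isOpen_lt continuous_const continuous_fst
  have hMo' : IsOpen {z : Strip | z.1 < M} := isOpen_lt continuous_fst continuous_const
  obtain ⟨n, hn⟩ : ∃ n, A n ∩ {z | M ≤ z.1} ⊆ (O ∩ {z | M < z.1}) ∪ O' := by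
    refine exists_subset_nhds_of_isCompact (V := fun n => A n ∩ {z | M ≤ z.1})
      (fun i j => ⟨max i j, inter_subset_inter_left _ (hanti (le_max_left _ _)),
        inter_subset_inter_left _ (hanti (le_max_right _ _))⟩)
      (fun n => isCompact_inter_of_subset (hclosed n) (hb n) M)
      (fun w hw => ((hO.inter hMo).union hO').mem_nhds ?_)
    have hwK : w ∈ K := by
      rw [hK, iInter_inter]
      exact hw
    by_cases hwZ : (⟨w, hwK⟩ : K) ∈ Z
    · exact .inl ⟨hZO ⟨_, hwZ, rfl⟩, hZM _ hwZ⟩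
    · exact .inr (hZO' ⟨_, hwZ, rfl⟩)
  -- Some `A n` already splits along `O` and `O'`. A connected subset of `A n` starting near `z` is
  -- then trapped in `O`, to the right of `M`.
  obtain ⟨S, -, hSd, hS⟩ := hA n
  obtain ⟨w, hwO, hwS⟩ := mem_closure_iff.1 (hSd (mem_iInter.1 hz n)) _ (hO.inter hMo)
    ⟨hZO ⟨_, hzZ, rfl⟩, hZM _ hzZ⟩
  obtain ⟨C, hCA, hwC, hCpre, hCunb⟩ := hS w hwS
  have hCO : C ⊆ O ∩ {z | M < z.1} := by
    refine hCpre.subset_left_of_subset_union (hO.inter hMo) (hO'.union hMo') ?_ ?_ ⟨w, hwC, hwO⟩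
    · rw [disjoint_union_right]
      refine ⟨hdisj.mono_left inter_subset_left, ?_⟩
      rw [Set.disjoint_left]
      rintro v ⟨-, hv⟩ hv'
      simp only [mem_ofPred_eq] at hv hv'
      exact lt_asymm hv hv'
    · intro v hv
      rcases lt_or_ge v.1 M with h | h
      · exact .inr (.inr h)
      · exact (hn ⟨hCA hv, h⟩).imp_right .inl
  refine hCunb ⟨M, ?_⟩
  rintro _ ⟨v, hv, rfl⟩
  exact (hCO hv).2.le

/-! ### Consequences of the existence of a dense orbit -/

theorem zpow_apply_iff {P : Strip → Prop} {G : Strip ≃ₜ Strip} (h : ∀ z, P (G z) ↔ P z) (n : ℤ)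
    (z : Strip) : P ((G ^ n) z) ↔ P z := by
  induction n using Int.induction_on generalizing z with
  | zero => rfl
  | succ n ih =>
    rw [zpow_add_one]
    exact (ih (G z)).trans (h z)
  | pred n ih =>
    rw [zpow_sub_one]
    refine (ih (G⁻¹ z)).trans ?_
    rw [← h (G⁻¹ z)]
    exact iff_of_eq (congrArg P (G.apply_symm_apply z))

theorem exists_zpow_image_inter {G : Strip ≃ₜ Strip} {z : Strip}
    (hz : Dense (range fun n : ℤ => (G ^ n) z)) {U V : Set Strip} (hU : IsOpen U)
    (hU' : U.Nonempty) (hV : IsOpen V) (hV' : V.Nonempty) :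
    ∃ n : ℤ, ((G ^ n) '' U ∩ V).Nonempty := by
  obtain ⟨-, hi, i, rfl⟩ := hz.inter_open_nonempty U hU hU'
  obtain ⟨-, hj, j, rfl⟩ := hz.inter_open_nonempty V hV hV'
  refine ⟨j - i, _, ⟨_, hi, rfl⟩, ?_⟩
  have : (G ^ (j - i)) ((G ^ i) z) = (G ^ j) z := by
    rw [← Homeomorph.mul_apply, ← zpow_add, sub_add_cancel]
  rwa [this]

/-- No open backward invariant set `D` is left by an open set of points: whenever `E` is open
and disjoint from `D`, no point of `D` is mapped into `E`. -/
def IsNontrapping (G : Strip ≃ₜ Strip) : Prop :=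
  ∀ D E : Set Strip, IsOpen D → IsOpen E → Disjoint D E → (∀ w, G w ∈ D → w ∈ D) →
    ∀ b ∈ D, G b ∉ E

/-- The points of `D` sent into `E` form an open set. If nonempty, it is visited by the dense orbit
at two distinct times, as the strip has no isolated points. After the first visit the orbit is in
`E`, yet its return to `D` would put that same point in `D` by backward invariance. -/
theorem isNontrapping_of_dense {G : Strip ≃ₜ Strip} {z : Strip}
    (hz : Dense (range fun n : ℤ => (G ^ n) z)) : IsNontrapping G := by
  intro D E hD hE hDE hback b hbD hbE
  have hback' : ∀ (k : ℕ) (w : Strip), (G ^ k) w ∈ D → w ∈ D := by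
    intro k
    induction k with
    | zero => exact fun w hw => hw
    | succ k ih =>
      intro w hw
      rw [pow_succ] at hw
      exact hback w (ih (G w) hw)
  have hW : IsOpen (D ∩ G ⁻¹' E) := hD.inter (hE.preimage G.continuous)
  have hlt : ∀ i j : ℤ, i < j → (G ^ i) z ∈ D ∩ G ⁻¹' E → (G ^ j) z ∈ D ∩ G ⁻¹' E → False := by
    intro i j hij hi hj
    obtain ⟨k, hk⟩ := Int.eq_ofNat_of_zero_le (show 0 ≤ j - (i + 1) by omega)
    have hj' : (G ^ j) z = (G ^ k) (G ((G ^ i) z)) := by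
      have : j = k + (1 + i) := by omega
      rw [this, zpow_add, zpow_add, zpow_natCast, zpow_one]
      rfl
    have h1 : G ((G ^ i) z) ∈ D := hback' k _ (hj' ▸ hj.1)
    exact Set.disjoint_left.1 hDE h1 hi.2
  obtain ⟨-, hi, i, rfl⟩ := hz.inter_open_nonempty _ hW ⟨b, hbD, hbE⟩
  have hz' : Dense ((range fun n : ℤ => (G ^ n) z) \ {(G ^ i) z}) := hz.sdiff_singleton _
  obtain ⟨-, hj, ⟨j, rfl⟩, hne⟩ := hz'.inter_open_nonempty _ hW ⟨b, hbD, hbE⟩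
  rcases lt_trichotomy i j with h | rfl | h
  · exact hlt i j h hi hj
  · exact hne rfl
  · exact hlt j i h hj hi

/-! ### Homeomorphisms moving the bottom line to the right -/

/-- A homeomorphism of the strip commuting with the deck transformation, preserving the bottom
line and moving each of its points to the right. -/
structure IsRightward (G : Strip ≃ₜ Strip) : Prop where
  map_add_one : ∀ x y, G (x + 1, y) = ((G (x, y)).1 + 1, (G (x, y)).2)
  bottom_iff : ∀ z, (G z).2 = 0 ↔ z.2 = 0
  lt_apply : ∀ x, x < (G (x, 0)).1

theorem IsRightward.map_add_int {G : Strip ≃ₜ Strip} (hG : IsRightward G) (m : ℤ) (x : ℝ)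
    (y : unitInterval) : G (x + m, y) = ((G (x, y)).1 + m, (G (x, y)).2) := by
  induction m using Int.induction_on with
  | zero => simp
  | succ m ih =>
    push_cast at ih ⊢
    rw [← add_assoc, hG.map_add_one, ih, add_assoc]
  | pred m ih =>
    have h := hG.map_add_one (x + ((-m - 1 : ℤ) : ℝ)) y
    have h' : x + ((-m - 1 : ℤ) : ℝ) + 1 = x + ((-m : ℤ) : ℝ) := by push_cast; ring
    rw [h', ih] at h
    have h1 := congrArg Prod.fst h
    have h2 := congrArg Prod.snd h
    simp only at h1 h2
    refine Prod.ext ?_ h2.symm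
    push_cast at h1 ⊢
    linarith

/-- The points close to the bottom line move to the right as well. -/
theorem IsRightward.exists_lt_apply {G : Strip ≃ₜ Strip} (hG : IsRightward G) :
    ∃ ε : unitInterval, 0 < ε ∧ ∀ z : Strip, z.2 < ε → z.1 < (G z).1 := by
  have hopen : IsOpen {z : Strip | z.1 < (G z).1} :=
    isOpen_lt continuous_fst (continuous_fst.comp G.continuous)
  -- Commutation with the deck group reduces the uniformity of `ε` to the compact segment `[0,1]` of
  -- the bottom line.
  obtain ⟨u, v, -, hv, hu', hv', huv⟩ := generalized_tube_lemma (isCompact_Icc (a := (0 : ℝ))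
    (b := 1)) (isCompact_singleton (x := (0 : unitInterval))) hopen (by
      rintro ⟨x, y⟩ ⟨-, rfl⟩
      exact hG.lt_apply x)
  obtain ⟨ε, hε, hεv⟩ := exists_Ico_subset_of_mem_nhds (hv.mem_nhds (hv' rfl))
    ⟨(1 : unitInterval), zero_lt_one⟩
  refine ⟨ε, hε, fun z hz => ?_⟩
  have hmem : ((Int.fract z.1, z.2) : Strip) ∈ {z : Strip | z.1 < (G z).1} :=
    huv ⟨hu' ⟨Int.fract_nonneg _, (Int.fract_lt_one _).le⟩, hεv ⟨z.2.2.1, hz⟩⟩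
  have h := hG.map_add_int ⌊z.1⌋ (Int.fract z.1) z.2
  rw [Int.fract_add_floor] at h
  have h1 := congrArg Prod.fst h
  simp only [mem_ofPred_eq] at hmem h1
  have := Int.fract_add_floor z.1
  linarith

/-- A closed invariant set which is bounded to the right does not meet the bottom line. -/
theorem IsRightward.snd_ne_zero {G : Strip ≃ₜ Strip} (hG : IsRightward G) {K : Set Strip}
    (hK : IsClosed K) (hinv : ∀ z, G z ∈ K ↔ z ∈ K) {b : ℝ} (hb : K ⊆ {z | z.1 ≤ b})
    {z : Strip} (hz : z ∈ K) : z.2 ≠ 0 := by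
  intro hz0
  have hc : IsClosed {x : ℝ | ((x, 0) : Strip) ∈ K} :=
    hK.preimage (continuous_id.prodMk continuous_const)
  have hbdd : BddAbove {x : ℝ | ((x, 0) : Strip) ∈ K} := ⟨b, fun x hx => hb hx⟩
  have hne : {x : ℝ | ((x, 0) : Strip) ∈ K}.Nonempty := ⟨z.1, by
    rw [mem_ofPred_eq, ← hz0]
    exact hz⟩
  have hs := hc.csSup_mem hne hbdd
  set s := sSup {x : ℝ | ((x, 0) : Strip) ∈ K} with hsdef
  have h1 : G (s, 0) ∈ K := (hinv _).2 hs
  have h2 : G (s, 0) = ((G (s, 0)).1, 0) := Prod.ext rfl ((hG.bottom_iff (s, 0)).2 rfl)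
  rw [h2] at h1
  exact (hG.lt_apply s).not_ge (le_csSup hbdd h1)

/-- An invariant set all of whose points lie in connected subsets unbounded to the left cannot
come close to the bottom line: otherwise a short vertical segment from the bottom line to the set
would bound a backward invariant region. -/
theorem IsRightward.le_snd {G : Strip ≃ₜ Strip} (hG : IsRightward G) (hT : IsNontrapping G)
    {K : Set Strip} (hK : IsClosed K) (hinv : ∀ z, G z ∈ K ↔ z ∈ K)
    (hbot : ∀ z ∈ K, z.2 ≠ 0) (hunb : IsLeftUnbounded K)
    {ε : unitInterval} (hε0 : 0 < ε) (hε : ∀ z : Strip, z.2 < ε → z.1 < (G z).1)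
    {p : Strip} (hp : p ∈ K) : ε ≤ p.2 := by
  by_contra! hpε
  set x₀ := p.1 with hx₀
  have hcomp : IsCompact (K ∩ {x₀} ×ˢ Iic p.2) :=
    ((isCompact_singleton (x := x₀)).prod (isClosed_Iic (a := p.2)).isCompact).inter_left hK
  -- `q` is the lowest point of `K` on the vertical line through `p`, so that the segment below it
  -- meets `K` only at its tip.
  obtain ⟨q, ⟨hqK, hq1, hq2⟩, hqmin⟩ := hcomp.exists_isMinOn ⟨p, hp, rfl, mem_Iic.2 le_rfl⟩
    continuous_snd.continuousOn
  have hq1 : q.1 = x₀ := hq1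
  have hlow : ∀ z ∈ K, z.1 = x₀ → q.2 ≤ z.2 := by
    intro z hz hz1
    rcases le_total z.2 p.2 with h | h
    · exact hqmin ⟨hz, hz1, h⟩
    · exact le_trans hq2 h
  have hqε : q.2 < ε := lt_of_le_of_lt hq2 hpε
  have hq0 : 0 < q.2 := unitInterval.pos_iff_ne_zero.2 (hbot q hqK)
  set V : Set Strip := {x₀} ×ˢ Iic q.2 with hV
  set V' : Set Strip := {x₀} ×ˢ Iio q.2 with hV'
  have hVpre : IsPreconnected V := isPreconnected_singleton.prod isPreconnected_Iic
  have hV'pre : IsPreconnected V' := isPreconnected_singleton.prod isPreconnected_Iio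
  have hVclosed : IsClosed V := isClosed_singleton.prod isClosed_Iic
  set U : Set Strip := (K ∪ V)ᶜ with hUdef
  have hU : IsOpen U := (hK.union hVclosed).isOpen_compl
  have hbotU : ∀ x : ℝ, x ≠ x₀ → ((x, 0) : Strip) ∈ U := by
    rintro x hx (h | h)
    · exact hbot _ h rfl
    · exact hx h.1
  have hbotV : ((x₀, 0) : Strip) ∈ V := ⟨rfl, hq0.le⟩
  obtain ⟨x₁, hx₁, hx₁'⟩ : ∃ x₁, x₀ < (G (x₁, 0)).1 ∧ x₁ < x₀ := by
    have hopen : IsOpen {x : ℝ | x₀ < (G (x, 0)).1} := isOpen_lt continuous_const (by fun_prop)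
    have hev : ∀ᶠ x in 𝓝[<] x₀, x₀ < (G (x, 0)).1 :=
      nhdsWithin_le_nhds (hopen.mem_nhds (hG.lt_apply x₀))
    exact (hev.and self_mem_nhdsWithin).exists
  have hGx₁ : G (x₁, 0) = ((G (x₁, 0)).1, 0) := Prod.ext rfl ((hG.bottom_iff (x₁, 0)).2 rfl)
  have hleft : Iio x₀ ×ˢ {0} ⊆ connectedComponentIn U (x₁, 0) := by
    refine (isPreconnected_Iio.prod isPreconnected_singleton).subset_connectedComponentIn
      ⟨hx₁', rfl⟩ ?_
    rintro ⟨x, y⟩ ⟨hx, rfl⟩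
    exact hbotU x (ne_of_lt hx)
  have hright : Ioi x₀ ×ˢ {0} ⊆ connectedComponentIn U (G (x₁, 0)) := by
    refine (isPreconnected_Ioi.prod isPreconnected_singleton).subset_connectedComponentIn
      ⟨hx₁, (hG.bottom_iff (x₁, 0)).2 rfl⟩ ?_
    rintro ⟨x, y⟩ ⟨hx, rfl⟩
    exact hbotU x (ne_of_gt hx)
  -- A path in `U` from left to right would have to cross the segment `V` continued by an unbounded
  -- connected subset of `K` through `q`.
  have hdisj : Disjoint (connectedComponentIn U (x₁, 0)) (connectedComponentIn U (G (x₁, 0))) := by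
    rw [Set.disjoint_left]
    intro z hz hz'
    have heq := (connectedComponentIn_eq hz).trans (connectedComponentIn_eq hz').symm
    have hj := joinedIn_of_isPreconnected
      (isPreconnected_connectedComponentIn (x := ((x₁, 0) : Strip))) hU
      (connectedComponentIn_subset U _) (mem_connectedComponentIn (hbotU x₁ hx₁'.ne))
      (heq ▸ hright ⟨hx₁, (hG.bottom_iff (x₁, 0)).2 rfl⟩)
    obtain ⟨C, hCK, hqC, hCpre, hCunb⟩ := hunb q hqK
    obtain ⟨t, ht⟩ := exists_mem_of_bottom_bottom hj.somePath rfl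
      ((hG.bottom_iff (x₁, 0)).2 rfl)
      (IsPreconnected.union (s := V) q ⟨hq1, mem_Iic.2 le_rfl⟩ hqC hVpre hCpre) (.inl hbotV) rfl hx₁' hx₁
      (fun h => hCunb (h.mono (image_mono subset_union_right)))
    exact hj.somePath_mem t (ht.elim .inr fun h => .inl (hCK h))
  -- The image of the open segment misses `K` by invariance, and misses `V` because points below
  -- height `ε` move strictly to the right.
  have hGV' : G '' V' ⊆ connectedComponentIn U (G (x₁, 0)) := by
    have hmem : G (x₀, 0) ∈ connectedComponentIn U (G (x₁, 0)) :=
      hright ⟨hG.lt_apply x₀, (hG.bottom_iff (x₀, 0)).2 rfl⟩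
    rw [connectedComponentIn_eq hmem]
    refine (hV'pre.image _ G.continuous.continuousOn).subset_connectedComponentIn
      ⟨(x₀, 0), ⟨rfl, mem_Iio.2 hq0⟩, rfl⟩ ?_
    rintro _ ⟨z, ⟨hz1, hz2⟩, rfl⟩ (h | h)
    · exact (hlow z ((hinv z).1 h) hz1).not_gt hz2
    · have := hε z (lt_trans hz2 hqε)
      rw [hz1, h.1] at this
      exact lt_irrefl _ this
  refine hT _ _ hU.connectedComponentIn hU.connectedComponentIn hdisj ?_ (x₁, 0)
    (mem_connectedComponentIn (hbotU x₁ hx₁'.ne))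
    (hright ⟨hx₁, (hG.bottom_iff (x₁, 0)).2 rfl⟩)
  -- The preimage of the left component is connected and contains a bottom point further left. It
  -- misses `K` by invariance and `V'` by `hGV'`; the tip `q` belongs to `K`.
  intro w hw
  have hb2 : (G.symm (x₁, 0)).2 = 0 := by
    rw [← hG.bottom_iff, G.apply_symm_apply]
  have hb1 : (G.symm (x₁, 0)).1 < x₁ := by
    have := hε (G.symm (x₁, 0)) (hb2.trans_lt hε0)
    rwa [G.apply_symm_apply] at this
  rw [connectedComponentIn_eq (hleft (show G.symm (x₁, 0) ∈ Iio x₀ ×ˢ {0} from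
    ⟨hb1.trans hx₁', hb2⟩))]
  refine (isPreconnected_connectedComponentIn (x := ((x₁, 0) : Strip)) (F := U) |>.image _
    G.symm.continuous.continuousOn).subset_connectedComponentIn
    ⟨_, mem_connectedComponentIn (hbotU x₁ hx₁'.ne), rfl⟩ ?_ ⟨_, hw, G.symm_apply_apply w⟩
  rintro _ ⟨z, hz, rfl⟩ hmem
  have hzU := connectedComponentIn_subset U _ hz
  rcases hmem with h | ⟨h1, h2⟩
  · rw [← hinv, G.apply_symm_apply] at h
    exact hzU (.inl h)
  · rcases eq_or_lt_of_le (mem_Iic.1 h2) with h3 | h3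
    · have : G.symm z = q := Prod.ext (h1.trans hq1.symm) h3
      rw [← this, ← hinv, G.apply_symm_apply] at hqK
      exact hzU (.inl hqK)
    · exact Set.disjoint_left.1 hdisj hz (hGV' ⟨_, ⟨h1, h3⟩, G.apply_symm_apply z⟩)

end Strip

namespace Strip

/-! ### The reflection of the strip -/

/-- The reflection `(x, y) ↦ (x, 1 - y)` of the strip. -/
def flip : Strip ≃ₜ Strip := (Homeomorph.refl ℝ).prodCongr unitInterval.symmHomeomorph

@[simp] theorem flip_apply (x : ℝ) (y : unitInterval) : flip (x, y) = (x, unitInterval.symm y) :=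
  rfl

@[simp] theorem flip_fst (z : Strip) : (flip z).1 = z.1 := rfl

@[simp] theorem flip_snd (z : Strip) : (flip z).2 = unitInterval.symm z.2 := rfl

@[simp] theorem flip_flip (z : Strip) : flip (flip z) = z := by
  ext <;> simp

/-- The conjugate of a homeomorphism of the strip by the reflection. -/
def flipConj (G : Strip ≃ₜ Strip) : Strip ≃ₜ Strip := flip.trans (G.trans flip)

theorem flipConj_apply (G : Strip ≃ₜ Strip) (z : Strip) : flipConj G z = flip (G (flip z)) := rfl

theorem IsNontrapping.flipConj {G : Strip ≃ₜ Strip} (hG : IsNontrapping G) :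
    IsNontrapping (flipConj G) := by
  intro D E hD hE hDE hback b hb hbE
  refine hG (flip ⁻¹' D) (flip ⁻¹' E) (hD.preimage flip.continuous) (hE.preimage flip.continuous)
    (hDE.preimage _) (fun w hw => hback (flip w) ?_) (flip b) ?_ hbE
  · rwa [flipConj_apply, flip_flip]
  · rwa [mem_preimage, flip_flip]

theorem IsLeftUnbounded.flip {K : Set Strip} (hK : IsLeftUnbounded K) :
    IsLeftUnbounded (flip ⁻¹' K) := by
  intro z hz
  obtain ⟨C, hCK, hzC, hCpre, hCunb⟩ := hK _ hz
  refine ⟨Strip.flip '' C, ?_, ⟨_, hzC, flip_flip z⟩,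
    hCpre.image _ Strip.flip.continuous.continuousOn, ?_⟩
  · rintro _ ⟨w, hw, rfl⟩
    rw [mem_preimage, flip_flip]
    exact hCK hw
  · rw [image_image]
    exact hCunb

/-! ### The main argument -/

/-- If a homeomorphism moves both boundary lines to the right and has a dense orbit, then it has no
nonempty closed invariant set bounded to the right all of whose points lie in connected subsets
unbounded to the left. -/
theorem eq_empty_of_isLeftUnbounded {G : Strip ≃ₜ Strip} {z₀ : Strip}
    (hz₀ : Dense (range fun n : ℤ => (G ^ n) z₀)) (hG : IsRightward G)
    (hG' : IsRightward (flipConj G)) {K : Set Strip} (hK : IsClosed K)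
    (hinv : ∀ z, G z ∈ K ↔ z ∈ K) {b : ℝ} (hb : K ⊆ {z | z.1 ≤ b}) (hunb : IsLeftUnbounded K) :
    K = ∅ := by
  by_contra hne
  obtain ⟨p, hp⟩ := nonempty_iff_ne_empty.2 hne
  have hT := isNontrapping_of_dense hz₀
  obtain ⟨ε, hε0, hε⟩ := hG.exists_lt_apply
  obtain ⟨η, hη0, hη⟩ := hG'.exists_lt_apply
  have hKε : ∀ z ∈ K, ε ≤ z.2 := fun z hz =>
    hG.le_snd hT hK hinv (fun z hz => hG.snd_ne_zero hK hinv hb hz) hunb hε0 hε hz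
  have hKη : ∀ z ∈ K, η ≤ unitInterval.symm z.2 := fun z hz => by
    have hK' : IsClosed (flip ⁻¹' K) := hK.preimage flip.continuous
    have hinv' : ∀ z, flipConj G z ∈ flip ⁻¹' K ↔ z ∈ flip ⁻¹' K := fun z => by
      rw [mem_preimage, mem_preimage, flipConj_apply, flip_flip]
      exact hinv _
    have hb' : flip ⁻¹' K ⊆ {z | z.1 ≤ b} := fun z hz =>
      show (flip z).1 ≤ b from hb (show flip z ∈ K from hz)
    refine hG'.le_snd hT.flipConj hK' hinv' (fun z hz => hG'.snd_ne_zero hK' hinv' hb' hz)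
      hunb.flip hη0 hη (p := flip z) ?_
    rwa [mem_preimage, flip_flip]
  set N : Set Strip := univ ×ˢ Iio ε with hN
  set N' : Set Strip := univ ×ˢ (unitInterval.symm ⁻¹' Iio η) with hN'
  have hNo : IsOpen N := isOpen_univ.prod isOpen_Iio
  have hN'o : IsOpen N' := isOpen_univ.prod (isOpen_Iio.preimage unitInterval.continuous_symm)
  have hNpre : IsPreconnected N := isPreconnected_univ.prod isPreconnected_Iio
  have hN'pre : IsPreconnected N' := by
    have : N' = flip ⁻¹' (univ ×ˢ Iio η) := rfl
    rw [this, ← flip.image_symm]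
    exact (isPreconnected_univ.prod isPreconnected_Iio).image _ flip.symm.continuous.continuousOn
  have h0N : ((0, 0) : Strip) ∈ N := ⟨mem_univ _, hε0⟩
  have h1N' : ((0, 1) : Strip) ∈ N' := ⟨mem_univ _, by simpa using hη0⟩
  obtain ⟨n, w, hwN, hwN'⟩ := exists_zpow_image_inter hz₀ hNo ⟨_, h0N⟩ hN'o ⟨_, h1N'⟩
  have hj : JoinedIn ((G ^ n) '' N ∪ N') ((G ^ n) (0, 0)) (0, 1) :=
    joinedIn_of_isPreconnected
      (IsPreconnected.union w hwN hwN' (hNpre.image _ (G ^ n).continuous.continuousOn) hN'pre)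
      (((G ^ n).isOpenMap _ hNo).union hN'o) Subset.rfl (.inl ⟨_, h0N, rfl⟩) (.inr h1N')
  have hcomp := isCompact_range (continuous_fst.comp hj.somePath.continuous)
  obtain ⟨l, hl⟩ := hcomp.bddBelow
  obtain ⟨u, hu⟩ := hcomp.bddAbove
  -- The translation by `m` puts `p` to the right of the path, and `c` is then chosen so far left in
  -- `C` that its translate stays to the left.
  obtain ⟨m, hm⟩ := exists_int_gt (u - p.1)
  obtain ⟨C, hCK, hpC, hCpre, hCunb⟩ := hunb p hp
  obtain ⟨-, ⟨c, hcC, rfl⟩, hc⟩ := not_bddBelow_iff.1 hCunb (l - m)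
  have hcont : Continuous fun z : Strip => ((z.1 + m, z.2) : Strip) := by fun_prop
  obtain ⟨t, q, hqC, hqt⟩ := exists_mem_of_bottom_top hj.somePath
    ((zpow_apply_iff (P := fun z => z.2 = 0) hG.bottom_iff n _).2 rfl) rfl
    (hCpre.image _ hcont.continuousOn) (mem_image_of_mem _ hcC) (mem_image_of_mem _ hpC)
    (fun x => by
      have := hl ⟨x, rfl⟩
      simp only [Function.comp_apply] at this ⊢
      linarith)
    (fun x => by
      have := hu ⟨x, rfl⟩
      simp only [Function.comp_apply] at this ⊢
      linarith)
  have hinvm : ∀ z : Strip, (((G z).1 - m, (G z).2) : Strip) ∈ K ↔ ((z.1 - m, z.2) : Strip) ∈ K := by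
    intro z
    have h := hG.map_add_int m (z.1 - m) z.2
    rw [sub_add_cancel] at h
    rw [← hinv (z.1 - m, z.2)]
    change G z = _ at h
    rw [h]
    simp
  have hqK : ((q.1 + m - m, q.2) : Strip) ∈ K := by
    rw [add_sub_cancel_right]
    exact hCK hqC
  rcases hj.somePath_mem t with h | h
  · rw [← hqt] at h
    obtain ⟨v, hv, hvq⟩ := h
    have := (zpow_apply_iff (P := fun z => ((z.1 - m, z.2) : Strip) ∈ K) hinvm n v).1
      (by rw [hvq]; exact hqK)
    exact (hKε _ this).not_gt hv.2
  · rw [← hqt] at h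
    exact (hKη _ hqK).not_gt h.2

end Strip

/-! ### The ω-limit set of `B⁻` as a closed invariant set unbounded to the left -/

namespace AnnulusHomeo.Lift

variable {f : AnnulusHomeo} (F : f.Lift)

theorem lt_apply_boundary (i : unitInterval) (hi : i = 0 ∨ i = 1)
    (h : 0 < F.boundaryRotationNumber i hi) (x : ℝ) : x < (F.toHomeomorph (x, i)).1 := by
  have h0 : ((0 : ℤ) : ℝ) < (F.boundaryMap i hi).translationNumber := by
    rw [Int.cast_zero]
    exact h
  have := CircleDeg1Lift.lt_map_of_int_lt_translationNumber _ h0 x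
  rw [Int.cast_zero, add_zero] at this
  exact this

theorem isRightward (h : 0 < F.boundaryRotationNumber 0 (.inl rfl)) :
    Strip.IsRightward F.toHomeomorph := by
  have hproj : ∀ z, (F.toHomeomorph z).2 = (f.toHomeomorph z.proj).2 := fun z =>
    congrArg Prod.snd (F.proj_apply z)
  refine ⟨fun x y => f.orientation F.toHomeomorph F.toHomeomorph.continuous F.proj_apply (x, y),
    fun z => ⟨fun hz => ?_, fun hz => ?_⟩, F.lt_apply_boundary 0 _ h⟩
  · rw [hproj] at hz
    have hmem : f.toHomeomorph z.proj ∈ {z : Annulus | z.2 = 0} := hz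
    rw [← f.boundary 0 (.inl rfl)] at hmem
    obtain ⟨w, hw, hwz⟩ := hmem
    rw [f.toHomeomorph.injective hwz] at hw
    exact hw
  · have : z = (z.1, 0) := Prod.ext rfl hz
    rw [this]
    exact F.apply_boundary 0 (.inl rfl) z.1

theorem isRightward_flipConj (h : 0 < F.boundaryRotationNumber 1 (.inr rfl)) :
    Strip.IsRightward (Strip.flipConj F.toHomeomorph) := by
  have hproj : ∀ z, (F.toHomeomorph z).2 = (f.toHomeomorph z.proj).2 := fun z =>
    congrArg Prod.snd (F.proj_apply z)
  have hsymm : ∀ y : unitInterval, unitInterval.symm y = 0 ↔ y = 1 := fun y => by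
    rw [← unitInterval.symm_one, unitInterval.symm_inj]
  refine ⟨fun x y => ?_, fun z => ⟨fun hz => ?_, fun hz => ?_⟩, fun x => ?_⟩
  · have := f.orientation F.toHomeomorph F.toHomeomorph.continuous F.proj_apply
      (x, unitInterval.symm y)
    exact congrArg Strip.flip this
  · rw [Strip.flipConj_apply, Strip.flip_snd, hsymm, hproj] at hz
    have hmem : f.toHomeomorph (Strip.flip z).proj ∈ {z : Annulus | z.2 = 1} := hz
    rw [← f.boundary 1 (.inr rfl)] at hmem
    obtain ⟨w, hw, hwz⟩ := hmem
    rw [f.toHomeomorph.injective hwz] at hw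
    have hw' : unitInterval.symm z.2 = 1 := hw
    rw [← unitInterval.symm_symm z.2, hw', unitInterval.symm_one]
  · have : z = (z.1, 0) := Prod.ext rfl hz
    rw [this, Strip.flipConj_apply, Strip.flip_snd, hsymm, Strip.flip_apply, unitInterval.symm_zero]
    exact F.apply_boundary 1 (.inr rfl) z.1
  · rw [Strip.flipConj_apply, Strip.flip_fst, Strip.flip_apply, unitInterval.symm_zero]
    exact F.lt_apply_boundary 1 _ h x

/-- The closure of the union of the iterates of `D` from time `n` on. -/
def tail (D : Set Strip) (n : ℕ) : Set Strip :=
  closure (⋃ (i : ℕ) (_ : n ≤ i), (F.toHomeomorph ^ i) '' D)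

theorem antitone_tail (D : Set Strip) : Antitone (F.tail D) := fun _ _ hnm =>
  closure_mono (iUnion_mono fun _ => iUnion_mono' fun hi => ⟨hnm.trans hi, Subset.rfl⟩)

theorem image_subset_tail (D : Set Strip) {n i : ℕ} (hi : n ≤ i) :
    (F.toHomeomorph ^ i) '' D ⊆ F.tail D n :=
  (subset_iUnion₂ (s := fun (i : ℕ) (_ : n ≤ i) => (F.toHomeomorph ^ i) '' D) i hi).trans
    subset_closure

theorem apply_mem_tail_iff (D : Set Strip) (n : ℕ) (z : Strip) :
    F.toHomeomorph z ∈ F.tail D (n + 1) ↔ z ∈ F.tail D n := by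
  have himage : F.tail D (n + 1) = F.toHomeomorph '' F.tail D n := by
    rw [tail, tail, F.toHomeomorph.image_closure, image_iUnion₂]
    congr 1
    ext w
    simp only [mem_iUnion, image_image]
    constructor
    · rintro ⟨i, hi, v, hv, rfl⟩
      obtain ⟨j, rfl⟩ := Nat.exists_eq_add_of_le hi
      refine ⟨n + j, by omega, v, hv, ?_⟩
      rw [show n + 1 + j = n + j + 1 by omega, pow_succ' _ (n + j)]
      rfl
    · rintro ⟨i, hi, v, hv, rfl⟩
      refine ⟨i + 1, by omega, v, hv, ?_⟩
      rw [pow_succ']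
      rfl
  rw [himage, F.toHomeomorph.injective.mem_set_image]

theorem apply_mem_omegaLimitSet_iff (D : Set Strip) (z : Strip) :
    F.toHomeomorph z ∈ F.omegaLimitSet D ↔ z ∈ F.omegaLimitSet D := by
  have h : ∀ w, w ∈ F.omegaLimitSet D ↔ ∀ n, w ∈ F.tail D n := fun w => mem_iInter
  rw [h, h]
  refine ⟨fun hz n => (F.apply_mem_tail_iff D n z).1 (hz (n + 1)), fun hz n => ?_⟩
  exact F.antitone_tail D n.le_succ ((F.apply_mem_tail_iff D n z).2 (hz n))

theorem pow_apply_fst_nonpos {z : Strip} (hz : z ∈ F.B) (i : ℕ) :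
    ((F.toHomeomorph ^ i) z).1 ≤ 0 := by
  obtain ⟨w, hw, hwz⟩ := mem_iInter₂.1 hz (-i) (by omega)
  have : (F.toHomeomorph ^ i) z = w := by
    rw [← hwz, zpow_neg, zpow_natCast]
    exact (F.toHomeomorph ^ i).apply_symm_apply w
  rw [this]
  exact hw

theorem tail_Bminus_subset (n : ℕ) : F.tail F.Bminus n ⊆ {z | z.1 ≤ 0} := by
  refine closure_minimal (iUnion₂_subset fun i _ => ?_)
    (isClosed_le continuous_fst continuous_const)
  rintro _ ⟨z, hz, rfl⟩
  exact F.pow_apply_fst_nonpos hz.1 i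

/-- The iterates of a subset of `B` which is unbounded to the left are unbounded to the left. -/
theorem not_bddBelow_image {C : Set Strip} (hC : C ⊆ F.B) (h : ¬ BddBelow (Prod.fst '' C)) (i : ℕ) :
    ¬ BddBelow (Prod.fst '' ((F.toHomeomorph ^ i) '' C)) := by
  rintro ⟨m, hm⟩
  -- Iterates of `B` stay in `z.1 ≤ 0`, so a lower bound would confine the image to a compact box,
  -- whose preimage is bounded.
  have hcomp := ((isCompact_Icc (a := m) (b := 0)).prod (isCompact_univ (X := unitInterval))).image
    (continuous_fst.comp (F.toHomeomorph ^ i).symm.continuous)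
  refine h (hcomp.bddBelow.mono ?_)
  rintro _ ⟨z, hz, rfl⟩
  refine ⟨(F.toHomeomorph ^ i) z, ⟨⟨hm ⟨_, ⟨z, hz, rfl⟩, rfl⟩,
    F.pow_apply_fst_nonpos (hC hz) i⟩, mem_univ _⟩, ?_⟩
  simp only [Function.comp_apply, Homeomorph.symm_apply_apply]

theorem isLeftUnbounded_omegaLimitSet : Strip.IsLeftUnbounded (F.omegaLimitSet F.Bminus) := by
  refine Strip.isLeftUnbounded_iInter (F.antitone_tail _) (fun n => isClosed_closure)
    F.tail_Bminus_subset fun n => ⟨_, subset_closure, Subset.rfl, fun z hz => ?_⟩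
  obtain ⟨i, hi, w, hw, rfl⟩ := mem_iUnion₂.1 hz
  have hsub : connectedComponentIn F.B w ⊆ F.Bminus := fun v hv =>
    ⟨connectedComponentIn_subset _ _ hv, by rw [← connectedComponentIn_eq hv]; exact hw.2⟩
  exact ⟨(F.toHomeomorph ^ i) '' connectedComponentIn F.B w,
    (image_mono hsub).trans (F.image_subset_tail _ hi),
    mem_image_of_mem _ (mem_connectedComponentIn hw.1),
    isPreconnected_connectedComponentIn.image _ (F.toHomeomorph ^ i).continuous.continuousOn,
    F.not_bddBelow_image (connectedComponentIn_subset _ _) hw.2 i⟩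

end AnnulusHomeo.Lift

/-- If the lift `F` of `f` is transitive and has positive rotation number on both boundary lines,
then the ω-limit set of `B⁻` is empty, and the iterates of `B⁻` converge to the left end of the
strip. -/
theorem theorem2 (f : AnnulusHomeo) (F : f.Lift) (htrans : F.IsTransitive)
    (hrot : ∀ (i : unitInterval) (hi : i = 0 ∨ i = 1), 0 < F.boundaryRotationNumber i hi) :
    F.omegaLimitSet F.Bminus = ∅ ∧
      ∀ a : ℝ, ∀ᶠ n : ℕ in atTop,
        (F.toHomeomorph ^ n) '' F.Bminus ⊆ {z : Strip | z.1 ≤ a} := by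
  obtain ⟨z₀, hz₀⟩ := htrans
  have hempty : F.omegaLimitSet F.Bminus = ∅ :=
    Strip.eq_empty_of_isLeftUnbounded hz₀ (F.isRightward (hrot 0 _))
      (F.isRightward_flipConj (hrot 1 _)) (isClosed_iInter fun n => isClosed_closure)
      (F.apply_mem_omegaLimitSet_iff _) ((iInter_subset _ 0).trans (F.tail_Bminus_subset 0))
      F.isLeftUnbounded_omegaLimitSet
  refine ⟨hempty, fun a => ?_⟩
  -- These are nested compact sets with empty intersection, so one of them is empty.
  obtain ⟨n, hn⟩ : ∃ n, F.tail F.Bminus n ∩ {z | a ≤ z.1} ⊆ ∅ := by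
    refine exists_subset_nhds_of_isCompact (V := fun n => F.tail F.Bminus n ∩ {z | a ≤ z.1})
      (fun i j => ⟨max i j, inter_subset_inter_left _ (F.antitone_tail _ (le_max_left _ _)),
        inter_subset_inter_left _ (F.antitone_tail _ (le_max_right _ _))⟩)
      (fun n => Strip.isCompact_inter_of_subset isClosed_closure (F.tail_Bminus_subset n) a)
      (fun w hw => ?_)
    have hw' : w ∈ F.omegaLimitSet F.Bminus :=
      mem_iInter.2 fun n => (mem_iInter.1 hw n).1
    rw [hempty] at hw'
    exact hw'.elim
  filter_upwards [eventually_ge_atTop n] with i hi z hz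
  by_contra hza
  exact hn ⟨F.image_subset_tail _ hi hz, show a ≤ z.1 from (not_le.1 hza).le⟩
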